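/- Let $G$ and $T$ be finite sets, let $(G,T;E)$ be a bipartite graph with edge set $E\subseteq G\times T$ and arbitrary real edge costs $c:E\to\mathbb{R}$, and let $\mathcal{M}=(T,\mathcal{I})$ be a matroid on $T$. For $S\subseteq G$ let $$v(S)=\max\Big\{\sum_{e\in N}c(e)\;:\;N\subseteq E\text{ is a matching},\ \delta_G(N)\subseteq S,\ \delta_T(N)\in\mathcal{I}\Big\},$$ where $\delta_G(N)$ and $\delta_T(N)$ denote the sets of endpoints of $N$ in $G$ and in $T$ (such a function $v$ is called a Rado valuation). Then $v$ is nonnegative with $v(\emptyset)=0$, and: 1. $v$ is M$^\natural$-concave: for all $X,Y\subseteq G$ and every $x\in X\setminus Y$, $$v(X)+v(Y)\le\max_{Z\subseteq Y\setminus X,\ |Z|\le 1}\Big(v\big((X\setminus\{x\})\cup Z\big)+v\big((Y\setminus Z)\cup\{x\}\big)\Big).$$ 2. $v$ is a gross substitutes valuation: for all price vectors $p,p'\in\mathbb{R}^G$ with $p\le p'$ coordinatewise and every set $S$ that maximizes $v(S)-\sum_{j\in S}p_j$ over all subsets of $G$, there is a set $S'$ that maximizes $v(S')-\sum_{j\in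 S'}p'_j$ over all subsets of $G$ and satisfies $S\cap\{j\in G: p_j=p'_j\}\subseteq S'$. -/

import Mathlib

/-- `N` is a matching of the bipartite graph with sides `G`, `T` and edge set `E`:
a set of edges of which no two distinct ones share an endpoint. -/
def IsBipMatching {G T : Type*} (E N : Finset (G × T)) : Prop :=
  N ⊆ E ∧ ∀ e ∈ N, ∀ f ∈ N, e ≠ f → e.1 ≠ f.1 ∧ e.2 ≠ f.2

/-- `N` is a matching whose endpoints in `G` all lie in `S` and whose set of endpoints in `T`
is independent in the matroid `M`. -/
def IsRadoFeasible {G T : Type*} [DecidableEq G] [DecidableEq T] (E : Finset (G × T))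
    (M : Matroid T) (S : Finset G) (N : Finset (G × T)) : Prop :=
  IsBipMatching E N ∧ N.image Prod.fst ⊆ S ∧ M.Indep (N.image Prod.snd : Finset T)

open Classical in
/-- The finite set of all feasible matchings for the item set `S`. -/
noncomputable def radoFeasible {G T : Type*} [DecidableEq G] [DecidableEq T]
    (E : Finset (G × T)) (M : Matroid T) (S : Finset G) : Finset (Finset (G × T)) :=
  E.powerset.filter (fun N => IsRadoFeasible E M S N)

theorem mem_radoFeasible {G T : Type*} [DecidableEq G] [DecidableEq T]
    {E : Finset (G × T)} {M : Matroid T} {S : Finset G} {N : Finset (G × T)} :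
    N ∈ radoFeasible E M S ↔ IsRadoFeasible E M S N := by
  simp only [radoFeasible, Finset.mem_filter, Finset.mem_powerset, and_iff_right_iff_imp]
  exact fun h => h.1.1

theorem radoFeasible_nonempty {G T : Type*} [DecidableEq G] [DecidableEq T]
    (E : Finset (G × T)) (M : Matroid T) (S : Finset G) : (radoFeasible E M S).Nonempty :=
  ⟨∅, mem_radoFeasible.2 (by simp [IsRadoFeasible, IsBipMatching])⟩

/-- The Rado valuation: the maximum cost of a feasible matching. Only the values of `c` on `E`
matter. -/
noncomputable def radoValuation {G T : Type*} [DecidableEq G] [DecidableEq T]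
    (E : Finset (G × T)) (c : G × T → ℝ) (M : Matroid T) (S : Finset G) : ℝ :=
  (radoFeasible E M S).sup' (radoFeasible_nonempty E M S) (fun N => ∑ e ∈ N, c e)

theorem radoValuation_isGreatest {G T : Type*} [DecidableEq G] [DecidableEq T]
    (E : Finset (G × T)) (c : G × T → ℝ) (M : Matroid T) (S : Finset G) :
    IsGreatest {r : ℝ | ∃ N, IsRadoFeasible E M S N ∧ r = ∑ e ∈ N, c e}
      (radoValuation E c M S) := by
  constructor
  · obtain ⟨N, hN, h⟩ := Finset.exists_mem_eq_sup' (radoFeasible_nonempty E M S)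
      (fun N => ∑ e ∈ N, c e)
    exact ⟨N, mem_radoFeasible.1 hN, h⟩
  · rintro r ⟨N, hN, rfl⟩
    exact Finset.le_sup' (fun N => ∑ e ∈ N, c e) (mem_radoFeasible.2 hN)

/-- A set function `v : 2^G → ℝ₊` is M♮-concave: for all `X`, `Y` and `x ∈ X \ Y`,
`v X + v Y ≤ max v((X \ {x}) ∪ Z) + v((Y \ Z) ∪ {x})`, the maximum being over the (finite,
nonempty) family of all `Z ⊆ Y \ X` with at most one element. -/
structure IsMNaturalConcave {G : Type*} [DecidableEq G] (v : Finset G → ℝ) : Prop where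
  nonneg : ∀ S, 0 ≤ v S
  exchange : ∀ X Y : Finset G, ∀ x ∈ X \ Y, ∃ Z : Finset G, Z ⊆ Y \ X ∧ Z.card ≤ 1 ∧
    v X + v Y ≤ v ((X \ {x}) ∪ Z) + v ((Y \ Z) ∪ {x})

/-- The demand correspondence: the sets `S` that maximize the utility `v(S) - p(S)`. -/
def demand {G : Type*} (v : Finset G → ℝ) (p : G → ℝ) : Set (Finset G) :=
  {S | ∀ S' : Finset G, v S' - ∑ j ∈ S', p j ≤ v S - ∑ j ∈ S, p j}

/-- `v : 2^G → ℝ₊` is a gross substitutes valuation. -/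
structure IsGrossSubstitutes {G : Type*} (v : Finset G → ℝ) : Prop where
  empty : v ∅ = 0
  nonneg : ∀ S, 0 ≤ v S
  substitutes : ∀ p p' : G → ℝ, p ≤ p' → ∀ S ∈ demand v p,
    ∃ S' ∈ demand v p', ∀ j ∈ S, p j = p' j → j ∈ S'

/-! A Rado valuation arises from a weighted matroid rank function on edges by aggregation. Pulling
`M` back along `Prod.snd` and restricting to `E` gives a matroid on edges whose independent sets
satisfy every condition on the `T` side; the `G` side only asks for at most one edge over each item
of `S`. The weighted rank is M♮-concave by symmetric exchange (`weightedRank_exchange`), so it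
satisfies the three-term relations, also after inert points are adjoined
(`SatisfiesPlucker.of_exchange`). Give each item a point `(g, true)` and identify all edges at `g`
with it, one at a time: the item may be left unused or be replaced by one of its edges. The crux is
that identifying two points preserves the three-term relations (`SatisfiesPlucker.merge`), which
reduces to a statement about six points in rank three. Dummies `(g, false)` pad every item set to
size `|G|`. As all values are finite, the local relations give exchange between sets of equal size
(`SatisfiesPlucker.exchange`), and forgetting the dummies turns this into M♮-exchange. Gross
substitutes follows from one exchange between demanded sets. -/

/-! ### Three-term relations and equal-size exchange. -/

/-- The three-term tropical Plücker relations for a real-valued set function, restricted to the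
subsets of `W`. -/
def SatisfiesPlucker {V : Type*} [DecidableEq V] (W : Finset V) (ω : Finset V → ℝ) : Prop :=
  ∀ S ⊆ W, ∀ i ∈ W, ∀ j ∈ W, ∀ k ∈ W, ∀ l ∈ W, i ∉ S → j ∉ S → k ∉ S → l ∉ S →
    i ≠ j → i ≠ k → i ≠ l → j ≠ k → j ≠ l → k ≠ l →
    ω (insert i (insert j S)) + ω (insert k (insert l S)) ≤
      max (ω (insert i (insert k S)) + ω (insert j (insert l S)))
        (ω (insert i (insert l S)) + ω (insert j (insert k S)))

/-- The three-term relations imply the exchange property for sets of equal size. -/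
theorem SatisfiesPlucker.exchange {V : Type*} [DecidableEq V] {W : Finset V} {ω : Finset V → ℝ}
    (h : SatisfiesPlucker W ω) {X Y : Finset V} (hX : X ⊆ W) (hY : Y ⊆ W)
    (hc : X.card = Y.card) {x : V} (hx : x ∈ X \ Y) :
    ∃ y ∈ Y \ X, ω X + ω Y ≤ ω (insert y (X.erase x)) + ω (insert x (Y.erase y)) := by
  induction hn : (X \ Y).card using Nat.strong_induction_on generalizing Y with
  | _ n ih =>
  subst hn
  by_contra! hlt
  have hc' : (X \ Y).card = (Y \ X).card := Finset.card_sdiff_comm hc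
  obtain ⟨hxX, hxY⟩ := Finset.mem_sdiff.1 hx
  have hne : (Y \ X).Nonempty := by
    rw [← Finset.card_pos, ← hc']
    exact Finset.card_pos.2 ⟨x, hx⟩
  -- If `X \ Y` were just `{x}`, the only possible swap would interchange `X` and `Y`, giving
  -- equality.
  have hu : ∃ u ∈ X \ Y, u ≠ x := by
    by_contra! hu
    have hX1 : ∀ z ∈ X, z ∉ Y → z = x := fun z h1 h2 => hu z (Finset.mem_sdiff.2 ⟨h1, h2⟩)
    have h1 : (X \ Y).card ≤ 1 :=
      Finset.card_le_one.2 fun a ha b hb => (hu a ha).trans (hu b hb).symm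
    obtain ⟨y, hy⟩ := hne
    have hY1 : ∀ z ∈ Y, z ∉ X → z = y := fun z h2 h3 =>
      Finset.card_le_one.1 (hc' ▸ h1) z (Finset.mem_sdiff.2 ⟨h2, h3⟩) y hy
    obtain ⟨hyY, hyX⟩ := Finset.mem_sdiff.1 hy
    have e1 : insert y (X.erase x) = Y := by
      ext z
      simp only [Finset.mem_insert, Finset.mem_erase]
      grind
    have e2 : insert x (Y.erase y) = X := by
      ext z
      simp only [Finset.mem_insert, Finset.mem_erase]
      grind
    have := hlt y hy
    rw [e1, e2] at this
    linarith
  obtain ⟨u, hu, hux⟩ := hu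
  obtain ⟨huX, huY⟩ := Finset.mem_sdiff.1 hu
  -- Replacing `v` by `u` brings `Y` closer to `X`, so induction applies. Maximality of `v` is what
  -- cancels the terms with `Y - z + u` in the first case of `key`.
  obtain ⟨v, hv, hmax⟩ := Finset.exists_max_image (Y \ X)
    (fun v => ω (insert u (Y.erase v)) + ω (insert v (X.erase x))) hne
  obtain ⟨hvY, hvX⟩ := Finset.mem_sdiff.1 hv
  obtain ⟨z, hz, hzle⟩ := ih ((X \ insert u (Y.erase v)).card)
    (Finset.card_lt_card (by grind)) (Y := insert u (Y.erase v)) (by grind)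
    (by rw [Finset.card_insert_of_notMem (by grind), Finset.card_erase_of_mem hvY, hc]
        have := Finset.card_pos.2 ⟨v, hvY⟩
        omega) (by grind) rfl
  have hzY : z ∈ Y ∧ z ∉ X ∧ z ≠ v := by grind
  have key := h ((Y.erase v).erase z) (by grind) u (hX huX) x (hX hxX) v (hY hvY) z (hY hzY.1)
    (by grind) (by grind) (by grind) (by grind) hux (by grind) (by grind) (by grind) (by grind)
    hzY.2.2.symm
  have s1 : insert u (insert x ((Y.erase v).erase z)) =
      insert x ((insert u (Y.erase v)).erase z) := by grind
  have s2 : insert v (insert z ((Y.erase v).erase z)) = Y := by grind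
  have s3 : insert u (insert v ((Y.erase v).erase z)) = insert u (Y.erase z) := by grind
  have s4 : insert x (insert z ((Y.erase v).erase z)) = insert x (Y.erase v) := by grind
  have s5 : insert u (insert z ((Y.erase v).erase z)) = insert u (Y.erase v) := by grind
  have s6 : insert x (insert v ((Y.erase v).erase z)) = insert x (Y.erase z) := by grind
  rw [s1, s2, s3, s4, s5, s6] at key
  have hzm : z ∈ Y \ X := Finset.mem_sdiff.2 ⟨hzY.1, hzY.2.1⟩
  have m1 := hmax z hzm
  have l1 := hlt z hzm
  have l2 := hlt v hv
  rcases le_max_iff.1 key with hk | hk <;> linarith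

/-! ### Identifying two points preserves the three-term relations. -/

/-- A property of six-element rank-three valuations: the relations used when two elements are
identified. -/
theorem six_point_contradiction
    {ijk ijo ija ijb iko ika ikb ioa iob iab jka jkb joa job jab kob kab oab : ℝ}
    (g1 : ika + joa < ija + kob) (g2 : ika + job < ija + kob) (g4 : ikb + job < ija + kob)
    (g5 : ioa + jka < ija + kob) (g6 : ioa + jkb < ija + kob) (g8 : iob + jkb < ija + kob)
    (a0 : ija + kob ≤ iko + jab)
    (b1 : kob + jab ≤ jkb + oab)
    (r1 : ijb + oab ≤ max (iob + jab) (iab + job))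
    (r2 : ijb + joa ≤ max (ijo + jab) (ija + job))
    (r3 : job + ija ≤ max (ijo + jab) (joa + ijb))
    (r4 : ijb + kab ≤ max (ikb + jab) (iab + jkb))
    (r5 : ijk + jab ≤ max (ija + jkb) (ijb + jka))
    (r6 : ijb + jka ≤ max (ijk + jab) (ija + jkb))
    (r7 : iab + jka ≤ max (ija + kab) (ika + jab))
    (r8 : iko + ija ≤ max (ijk + ioa) (ika + ijo))
    (r9 : ijo + oab ≤ max (ioa + job) (iob + joa)) : False := by
  -- Each variable is named after a triple of points, `o` being the point called `l` in later
  -- lemmas. What remains is a finite case split over linear inequalities.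
  simp only [le_max_iff] at *
  grind

theorem SatisfiesPlucker.of_nodup {V : Type*} [DecidableEq V] {W : Finset V}
    {ω : Finset V → ℝ} (h : SatisfiesPlucker W ω) {S : Finset V} (hS : S ⊆ W) {i j k l : V}
    (hn : [i, j, k, l].Nodup) (hm : ∀ z ∈ [i, j, k, l], z ∈ W ∧ z ∉ S) :
    ω (insert i (insert j S)) + ω (insert k (insert l S)) ≤
      max (ω (insert i (insert k S)) + ω (insert j (insert l S)))
        (ω (insert i (insert l S)) + ω (insert j (insert k S))) := by
  simp only [List.nodup_cons, List.mem_cons, List.not_mem_nil, or_false, not_or,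
    forall_eq_or_imp, forall_eq] at hn hm
  obtain ⟨⟨h1, h2, h3⟩, ⟨h4, h5⟩, h6, -⟩ := hn
  obtain ⟨⟨m1, n1⟩, ⟨m2, n2⟩, ⟨m3, n3⟩, m4, n4⟩ := hm
  exact h S hS i m1 j m2 k m3 l m4 n1 n2 n3 n4 h1 h2 h3 h4 h5 h6

/-- The six-point contradiction for a symmetric function satisfying the rank-three Plücker
relations. -/
theorem six_point_contradiction_of_symm {w : Fin 6 → Fin 6 → Fin 6 → ℝ}
    (s12 : ∀ x y z, w x y z = w y x z) (s23 : ∀ x y z, w x y z = w x z y)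
    (rel : ∀ p x y u v, [p, x, y, u, v].Nodup →
      w x y p + w u v p ≤ max (w x u p + w y v p) (w x v p + w y u p))
    (h1 : ∀ c d, (c = 4 ∨ c = 5) → (d = 4 ∨ d = 5) → w 0 2 c + w 1 3 d < w 0 1 4 + w 2 3 5)
    (h2 : ∀ c d, (c = 4 ∨ c = 5) → (d = 4 ∨ d = 5) → w 0 3 c + w 1 2 d < w 0 1 4 + w 2 3 5)
    (h3 : w 0 1 4 + w 2 3 5 ≤ w 0 2 3 + w 1 4 5)
    (h4 : w 2 3 5 + w 1 4 5 ≤ w 1 2 5 + w 3 4 5) : False := by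
  -- The indices 0 to 5 stand for `i, j, k, l, a, b`. The rewrites below only sort the indices of
  -- each triple.
  have r1 := rel 5 0 1 3 4 (by decide)
  have r2 := rel 1 0 5 3 4 (by decide)
  have r3 := rel 1 3 5 0 4 (by decide)
  have r4 := rel 5 0 1 2 4 (by decide)
  have r5 := rel 1 0 2 4 5 (by decide)
  have r6 := rel 1 0 5 2 4 (by decide)
  have r7 := rel 4 0 5 1 2 (by decide)
  have r8 := rel 0 2 3 1 4 (by decide)
  have r9 := rel 3 0 1 4 5 (by decide)
  rw [s23 0 5 1, s23 3 4 1, s12 3 1 4, s23 0 3 1, s12 5 4 1, s23 4 5 1, s12 4 1 5, s23 0 4 1,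
    s12 5 3 1, s23 3 5 1, s12 3 1 5] at r2
  rw [s23 3 5 1, s12 3 1 5, s23 0 4 1, s12 3 0 1, s23 0 3 1, s12 5 4 1, s23 4 5 1, s12 4 1 5,
    s23 3 4 1, s12 3 1 4, s12 5 0 1, s23 0 5 1] at r3
  rw [s23 0 2 1, s23 4 5 1, s12 4 1 5, s23 0 4 1, s23 2 5 1, s12 2 1 5, s23 0 5 1, s23 2 4 1,
    s12 2 1 4] at r5
  rw [s23 0 5 1, s23 2 4 1, s12 2 1 4, s23 0 2 1, s12 5 4 1, s23 4 5 1, s12 4 1 5, s23 0 4 1,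
    s12 5 2 1, s23 2 5 1, s12 2 1 5] at r6
  rw [s23 0 5 4, s12 5 2 4, s23 2 5 4, s12 5 1 4, s23 1 5 4] at r7
  rw [s23 2 3 0, s12 2 0 3, s23 1 4 0, s12 1 0 4, s12 2 1 0, s23 1 2 0, s12 1 0 2, s23 3 4 0,
    s12 3 0 4, s23 2 4 0, s12 2 0 4, s12 3 1 0, s23 1 3 0, s12 1 0 3] at r8
  rw [s23 4 5 3, s12 4 3 5, s23 0 4 3, s23 1 5 3, s23 0 5 3, s23 1 4 3] at r9
  exact six_point_contradiction (h1 4 4 (.inl rfl) (.inl rfl)) (h1 4 5 (.inl rfl) (.inr rfl))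
    (h1 5 5 (.inr rfl) (.inr rfl)) (h2 4 4 (.inl rfl) (.inl rfl)) (h2 4 5 (.inl rfl) (.inr rfl))
    (h2 5 5 (.inr rfl) (.inr rfl)) h3 h4 r1 r2 r3 r4 r5 r6 r7 r8 r9

/-- Contracting `S` leaves a rank-three function on six points, which are then numbered by `Fin 6`.
-/
theorem SatisfiesPlucker.merge_contradiction {V : Type*} [DecidableEq V] {W : Finset V}
    {ω : Finset V → ℝ} (h : SatisfiesPlucker W ω) {S : Finset V} (hS : S ⊆ W)
    {i j k l a b : V} (hn : [i, j, k, l, a, b].Nodup)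
    (hm : ∀ z ∈ [i, j, k, l, a, b], z ∈ W ∧ z ∉ S) {A : ℝ}
    (hA : A = ω (insert i (insert j (insert a S))) + ω (insert k (insert l (insert b S))))
    (h1 : ∀ c ∈ [a, b], ∀ d ∈ [a, b],
      ω (insert i (insert k (insert c S))) + ω (insert j (insert l (insert d S))) < A)
    (h2 : ∀ c ∈ [a, b], ∀ d ∈ [a, b],
      ω (insert i (insert l (insert c S))) + ω (insert j (insert k (insert d S))) < A)
    (h3 : A ≤ ω (insert i (insert k (insert l S))) + ω (insert j (insert a (insert b S))))
    (h4 : ω (insert k (insert l (insert b S))) + ω (insert j (insert a (insert b S))) ≤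
      ω (insert j (insert k (insert b S))) + ω (insert l (insert a (insert b S)))) : False := by
  subst hA
  set e : Fin 6 → V := ![i, j, k, l, a, b] with he
  have hof : List.ofFn e = [i, j, k, l, a, b] := by simp [he, List.ofFn_succ]
  have hinj : Function.Injective e := List.nodup_ofFn.1 (hof ▸ hn)
  have hmem : ∀ x, e x ∈ W ∧ e x ∉ S := fun x => hm _ (hof ▸ List.mem_ofFn.2 ⟨x, rfl⟩)
  refine six_point_contradiction_of_symm
    (w := fun x y z => ω (insert (e x) (insert (e y) (insert (e z) S))))
    (fun x y z => congrArg ω (Finset.insert_comm _ _ _))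
    (fun x y z => congrArg ω (congrArg _ (Finset.insert_comm _ _ _)))
    (fun p x y u v hd => ?_) ?_ ?_ h3 h4
  · have hd' := hd.map hinj
    simp only [List.map_cons, List.map_nil] at hd'
    rw [List.nodup_cons] at hd'
    refine h.of_nodup (Finset.insert_subset (hmem p).1 hS) hd'.2 fun z hz => ?_
    refine ⟨?_, ?_⟩
    · simp only [List.mem_cons, List.not_mem_nil, or_false] at hz
      rcases hz with rfl | rfl | rfl | rfl <;> exact (hmem _).1
    · rw [Finset.mem_insert, not_or]
      refine ⟨fun e => hd'.1 (e ▸ hz), ?_⟩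
      simp only [List.mem_cons, List.not_mem_nil, or_false] at hz
      rcases hz with rfl | rfl | rfl | rfl <;> exact (hmem _).2
  · rintro c d (rfl | rfl) (rfl | rfl)
    exacts [h1 a (by simp) a (by simp), h1 a (by simp) b (by simp), h1 b (by simp) a (by simp),
      h1 b (by simp) b (by simp)]
  · rintro c d (rfl | rfl) (rfl | rfl)
    exacts [h2 a (by simp) a (by simp), h2 a (by simp) b (by simp), h2 b (by simp) a (by simp),
      h2 b (by simp) b (by simp)]

/-- The exchange needed when `a` and `b` are identified and occur on different sides. -/
theorem SatisfiesPlucker.merge_exchange {V : Type*} [DecidableEq V] {W : Finset V}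
    {ω : Finset V → ℝ} (h : SatisfiesPlucker W ω) {S : Finset V} (hS : S ⊆ W)
    {i j k l a b : V} (hn : [i, j, k, l, a, b].Nodup)
    (hm : ∀ z ∈ [i, j, k, l, a, b], z ∈ W ∧ z ∉ S) :
    ∃ c ∈ [a, b], ∃ d ∈ [a, b],
      ω (insert i (insert j (insert a S))) + ω (insert k (insert l (insert b S))) ≤
        ω (insert i (insert k (insert c S))) + ω (insert j (insert l (insert d S))) ∨
      ω (insert i (insert j (insert a S))) + ω (insert k (insert l (insert b S))) ≤
        ω (insert i (insert l (insert c S))) + ω (insert j (insert k (insert d S))) := by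
  by_contra! hlt
  have ha : a ∈ [a, b] := by simp
  have hb : b ∈ [a, b] := by simp
  have hab : a ≠ b := by grind
  -- Exchange `i` out of the left set: receiving `k` or `l` is excluded by `hlt`, so `b` comes in.
  have h0 : ω (insert i (insert j (insert a S))) + ω (insert k (insert l (insert b S))) ≤
      ω (insert i (insert k (insert l S))) + ω (insert j (insert a (insert b S))) := by
    obtain ⟨y, hy, hle⟩ := h.exchange (X := insert i (insert j (insert a S)))
      (Y := insert k (insert l (insert b S))) (x := i) (by grind) (by grind)
      (by
        rw [Finset.card_insert_of_notMem (by grind), Finset.card_insert_of_notMem (by grind),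
          Finset.card_insert_of_notMem (by grind), Finset.card_insert_of_notMem (by grind),
          Finset.card_insert_of_notMem (by grind), Finset.card_insert_of_notMem (by grind)])
      (by grind)
    have hyc : y = k ∨ y = l ∨ y = b := by grind
    have eX : (insert i (insert j (insert a S))).erase i = insert j (insert a S) :=
      Finset.erase_insert (by grind)
    rw [eX] at hle
    rcases hyc with rfl | rfl | rfl
    · have e : (insert y (insert l (insert b S))).erase y = insert l (insert b S) :=
        Finset.erase_insert (by grind)
      rw [e] at hle
      have := (hlt b hb a ha).2
      rw [Finset.insert_comm j y] at this
      linarith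
    · have e : (insert k (insert y (insert b S))).erase y = insert k (insert b S) := by
        rw [Finset.insert_comm]
        exact Finset.erase_insert (by grind)
      rw [e] at hle
      have := (hlt b hb a ha).1
      rw [Finset.insert_comm j y] at this
      linarith
    · have e : (insert k (insert l (insert y S))).erase y = insert k (insert l S) := by
        rw [Finset.insert_comm l, Finset.insert_comm k]
        exact Finset.erase_insert (by grind)
      rw [e, Finset.insert_comm y j, Finset.insert_comm y a] at hle
      linarith
  -- The two outcomes of this relation differ by swapping `k` and `l`, under which the problem is
  -- symmetric.
  have hr := h.of_nodup (S := insert b S) (i := k) (j := l) (k := j) (l := a) (by grind)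
    (by grind) (by grind)
  rcases le_max_iff.1 hr with hr | hr
  · exact h.merge_contradiction hS hn hm rfl (fun c hc d hd => (hlt c hc d hd).1)
      (fun c hc d hd => (hlt c hc d hd).2) h0 (by rwa [Finset.insert_comm k j] at hr)
  · refine h.merge_contradiction (k := l) (l := k) hS (by grind) (by grind)
      (congrArg _ (congrArg ω (Finset.insert_comm k l _))) (fun c hc d hd => (hlt c hc d hd).2)
      (fun c hc d hd => (hlt c hc d hd).1) ?_ ?_
    · rwa [Finset.insert_comm l k S]
    · rw [Finset.insert_comm l k, Finset.insert_comm j l]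
      linarith

/-- Identify the element `b` with `a`: a set containing `a` may use `b` in its place. -/
noncomputable def mergeElements {V : Type*} [DecidableEq V] (a b : V) (ω : Finset V → ℝ)
    (S : Finset V) : ℝ :=
  if a ∈ S then max (ω S) (ω (insert b (S.erase a))) else ω S

theorem mergeElements_of_notMem {V : Type*} [DecidableEq V] {a b : V} {ω : Finset V → ℝ}
    {S : Finset V} (h : a ∉ S) : mergeElements a b ω S = ω S := if_neg h

theorem mergeElements_insert {V : Type*} [DecidableEq V] {a b : V} {ω : Finset V → ℝ}
    {S : Finset V} (h : a ∉ S) :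
    mergeElements a b ω (insert a S) = max (ω (insert a S)) (ω (insert b S)) := by
  rw [mergeElements, if_pos (Finset.mem_insert_self a S), Finset.erase_insert h]

/-- When `a` is one of the four moving points, only one set in each pair contains it. The relations
for `a` and for `b` then suffice. -/
theorem SatisfiesPlucker.merge_left {V : Type*} [DecidableEq V] {W : Finset V}
    {ω : Finset V → ℝ} (h : SatisfiesPlucker W ω) {a b j k l : V} {S : Finset V}
    (hS : S ⊆ W.erase b) (hb : b ∈ W) (hn : [a, j, k, l].Nodup)
    (hm : ∀ z ∈ [a, j, k, l], z ∈ W.erase b ∧ z ∉ S) :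
    mergeElements a b ω (insert a (insert j S)) + mergeElements a b ω (insert k (insert l S)) ≤
      max (mergeElements a b ω (insert a (insert k S)) +
          mergeElements a b ω (insert j (insert l S)))
        (mergeElements a b ω (insert a (insert l S)) +
          mergeElements a b ω (insert j (insert k S))) := by
  have hS' : S ⊆ W := hS.trans (Finset.erase_subset _ _)
  have hbS : b ∉ S := fun hbS => Finset.notMem_erase b W (hS hbS)
  have ra := h.of_nodup hS' hn fun z hz => ⟨Finset.mem_of_mem_erase (hm z hz).1, (hm z hz).2⟩
  have rb := h.of_nodup (i := b) (j := j) (k := k) (l := l) hS' (by grind) (by grind)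
  rw [mergeElements_insert (by grind), mergeElements_insert (by grind),
    mergeElements_insert (by grind), mergeElements_of_notMem (by grind),
    mergeElements_of_notMem (by grind), mergeElements_of_notMem (by grind)]
  clear hm hn h
  grind

/-- With `a` in the common part, the two sets on the left choose `a` or `b` independently. Equal
choices are ordinary three-term relations; mixed choices need `merge_exchange`. -/
theorem SatisfiesPlucker.merge_of_mem {V : Type*} [DecidableEq V] {W : Finset V}
    {ω : Finset V → ℝ} (h : SatisfiesPlucker W ω) {a b i j k l : V} {S : Finset V}
    (hS : S ⊆ W) (hn : [i, j, k, l, a, b].Nodup)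
    (hm : ∀ z ∈ [i, j, k, l, a, b], z ∈ W ∧ z ∉ S) :
    mergeElements a b ω (insert i (insert j (insert a S))) +
        mergeElements a b ω (insert k (insert l (insert a S))) ≤
      max (mergeElements a b ω (insert i (insert k (insert a S))) +
          mergeElements a b ω (insert j (insert l (insert a S))))
        (mergeElements a b ω (insert i (insert l (insert a S))) +
          mergeElements a b ω (insert j (insert k (insert a S)))) := by
  have val : ∀ p ∈ [i, j, k, l], ∀ q ∈ [i, j, k, l],
      mergeElements a b ω (insert p (insert q (insert a S))) =
        max (ω (insert p (insert q (insert a S)))) (ω (insert p (insert q (insert b S)))) := by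
    intro p hp q hq
    rw [Finset.insert_comm q a, Finset.insert_comm p a, mergeElements_insert (by grind),
      Finset.insert_comm b p, Finset.insert_comm b q]
  rw [val i (by simp) j (by simp), val k (by simp) l (by simp), val i (by simp) k (by simp),
    val j (by simp) l (by simp), val i (by simp) l (by simp), val j (by simp) k (by simp)]
  have raa := h.of_nodup (S := insert a S) (i := i) (j := j) (k := k) (l := l) (by grind)
    (by grind) (by grind)
  have rbb := h.of_nodup (S := insert b S) (i := i) (j := j) (k := k) (l := l) (by grind)
    (by grind) (by grind)
  obtain ⟨c, hc, d, hd, rab⟩ := h.merge_exchange hS hn hm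
  obtain ⟨c', hc', d', hd', rba⟩ := h.merge_exchange (a := b) (b := a) (i := i) (j := j) (k := k)
    (l := l) hS (by grind) (by grind)
  have up : ∀ p q, ∀ c ∈ [a, b], ω (insert p (insert q (insert c S))) ≤
      max (ω (insert p (insert q (insert a S)))) (ω (insert p (insert q (insert b S)))) := by
    intro p q c hc
    simp only [List.mem_cons, List.not_mem_nil, or_false] at hc
    rcases hc with rfl | rfl
    exacts [le_max_left _ _, le_max_right _ _]
  have hc'' : c' ∈ [a, b] := by grind
  have hd'' : d' ∈ [a, b] := by grind
  have u1 := up i k c hc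
  have u2 := up j l d hd
  have u3 := up i l c hc
  have u4 := up j k d hd
  have u5 := up i k c' hc''
  have u6 := up j l d' hd''
  have u7 := up i l c' hc''
  have u8 := up j k d' hd''
  have v1 := up i k a (by simp)
  have v2 := up i k b (by simp)
  have v3 := up j l a (by simp)
  have v4 := up j l b (by simp)
  have v5 := up i l a (by simp)
  have v6 := up i l b (by simp)
  have v7 := up j k a (by simp)
  have v8 := up j k b (by simp)
  clear up val hm hn h
  rcases max_choice (ω (insert i (insert j (insert a S)))) (ω (insert i (insert j (insert b S))))
    with e | e <;>
  rcases max_choice (ω (insert k (insert l (insert a S)))) (ω (insert k (insert l (insert b S))))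
    with e' | e' <;> rw [e, e', le_max_iff]
  · exact (le_max_iff.1 raa).imp (fun r => by linarith) (fun r => by linarith)
  · exact rab.imp (fun r => by linarith) (fun r => by linarith)
  · exact rba.imp (fun r => by linarith) (fun r => by linarith)
  · exact (le_max_iff.1 rbb).imp (fun r => by linarith) (fun r => by linarith)

/-- Identifying two elements preserves the three-term relations. -/
theorem SatisfiesPlucker.merge {V : Type*} [DecidableEq V] {W : Finset V}
    {ω : Finset V → ℝ} (h : SatisfiesPlucker W ω) {a b : V} (ha : a ∈ W) (hb : b ∈ W)
    (hab : a ≠ b) : SatisfiesPlucker (W.erase b) (mergeElements a b ω) := by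
  intro S hS i hi j hj k hk l hl hiS hjS hkS hlS hij hik hil hjk hjl hkl
  by_cases haS : a ∈ S
  · obtain ⟨S, ha', rfl⟩ : ∃ S', a ∉ S' ∧ insert a S' = S :=
      ⟨S.erase a, Finset.notMem_erase a S, Finset.insert_erase haS⟩
    have hSW : S ⊆ W.erase b := (Finset.subset_insert a S).trans hS
    have hbS : b ∉ S := fun hbS => Finset.notMem_erase b W (hSW hbS)
    rw [Finset.mem_insert, not_or] at hiS hjS hkS hlS
    rw [Finset.mem_erase] at hi hj hk hl
    refine h.merge_of_mem (hSW.trans (Finset.erase_subset _ _)) ?_ ?_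
    · clear hS hSW h
      simp only [List.nodup_cons, List.mem_cons, List.not_mem_nil, or_false, not_or,
        List.nodup_nil, not_false_eq_true, and_true]
      tauto
    · simp only [List.mem_cons, List.not_mem_nil, or_false, forall_eq_or_imp, forall_eq]
      tauto
  by_cases hai : a = i
  · subst hai
    exact h.merge_left hS hb (by grind) (by grind)
  by_cases haj : a = j
  · subst haj
    have r := h.merge_left (a := a) (j := i) (k := k) (l := l) hS hb (by grind) (by grind)
    rw [Finset.insert_comm i a]
    rw [le_max_iff] at r ⊢
    exact r.symm.imp (fun r => by linarith) (fun r => by linarith)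
  by_cases hak : a = k
  · subst hak
    have r := h.merge_left (a := a) (j := l) (k := i) (l := j) hS hb (by grind) (by grind)
    rw [Finset.insert_comm i a, Finset.insert_comm j a, Finset.insert_comm i l,
      Finset.insert_comm j l]
    rw [le_max_iff] at r ⊢
    exact r.imp (fun r => by linarith) (fun r => by linarith)
  by_cases hal : a = l
  · subst hal
    have r := h.merge_left (a := a) (j := k) (k := i) (l := j) hS hb (by grind) (by grind)
    rw [Finset.insert_comm i a, Finset.insert_comm j a, Finset.insert_comm k a,
      Finset.insert_comm i k, Finset.insert_comm j k]
    rw [le_max_iff] at r ⊢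
    exact r.symm.imp (fun r => by linarith) (fun r => by linarith)
  rw [mergeElements_of_notMem (by grind), mergeElements_of_notMem (by grind),
    mergeElements_of_notMem (by grind), mergeElements_of_notMem (by grind),
    mergeElements_of_notMem (by grind), mergeElements_of_notMem (by grind)]
  exact h.of_nodup (by grind) (by grind) (by grind)

/-! ### Weighted matroid rank and its three-term relations. -/

/-- Any `y` in the fundamental circuit of `x` over `J` can be traded for `x` in `J`. If all of them
lay in the closure of `I \ {x}`, so would `x`, contradicting independence of `I`. -/
theorem Matroid.Indep.exists_symm_exchange {β : Type*} {M : Matroid β} {I J : Set β}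
    (hI : M.Indep I) (hJ : M.Indep J) {x : β} (hxI : x ∈ I) (hxJ : x ∉ J)
    (hd : ¬ M.Indep (insert x J)) :
    ∃ y ∈ J \ I, M.Indep (insert y (I \ {x})) ∧ M.Indep (insert x (J \ {y})) := by
  have hxE : x ∈ M.E := hI.subset_ground hxI
  have hcl : x ∈ M.closure J := by
    by_contra hcl
    exact hd ((hJ.notMem_closure_iff_of_notMem hxJ).1 hcl)
  have hC := hJ.fundCircuit_isCircuit hcl hxJ
  by_contra! hno
  have hsub : M.fundCircuit x J \ {x} ⊆ M.closure (I \ {x}) := by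
    rintro y ⟨hyC, hyx⟩
    have hyJ : y ∈ J := by
      rcases M.fundCircuit_subset_insert x J hyC with h | h
      · exact absurd h hyx
      · exact h
    by_cases hyI : y ∈ I
    · exact M.mem_closure_of_mem' ⟨hyI, hyx⟩ (hJ.subset_ground hyJ)
    by_contra hycl
    refine hno y ⟨hyJ, hyI⟩ ?_ ?_
    · exact ((hI.sdiff {x}).notMem_closure_iff (hJ.subset_ground hyJ)).1 hycl |>.1
    · have := (hJ.mem_fundCircuit_iff hcl hxJ).1 hyC
      rwa [← Set.insert_sdiff_singleton_comm (fun h => hyx h.symm)] at this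
  refine hI.notMem_closure_sdiff_of_mem hxI ?_
  exact M.closure_subset_closure_of_subset_closure hsub
    (hC.mem_closure_sdiff_singleton_of_mem (M.mem_fundCircuit x J))

open Classical in
/-- The independent subsets of a finite set. -/
noncomputable def indepSubsets {β : Type*} (M : Matroid β) (F : Finset β) : Finset (Finset β) :=
  F.powerset.filter (fun I => M.Indep I)

theorem mem_indepSubsets {β : Type*} {M : Matroid β} {F I : Finset β} :
    I ∈ indepSubsets M F ↔ I ⊆ F ∧ M.Indep I := by
  simp [indepSubsets]

theorem indepSubsets_nonempty {β : Type*} (M : Matroid β) (F : Finset β) :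
    (indepSubsets M F).Nonempty :=
  ⟨∅, mem_indepSubsets.2 ⟨Finset.empty_subset F, by simp⟩⟩

/-- The weighted rank function of a matroid: the largest weight of an independent subset. -/
noncomputable def weightedRank {β : Type*} (M : Matroid β) (c : β → ℝ) (F : Finset β) : ℝ :=
  (indepSubsets M F).sup' (indepSubsets_nonempty M F) (fun I => ∑ e ∈ I, c e)

theorem sum_le_weightedRank {β : Type*} {M : Matroid β} (c : β → ℝ) {F I : Finset β}
    (hI : I ⊆ F) (hind : M.Indep I) : ∑ e ∈ I, c e ≤ weightedRank M c F :=
  Finset.le_sup' (fun I => ∑ e ∈ I, c e) (mem_indepSubsets.2 ⟨hI, hind⟩)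

theorem exists_weightedRank_eq {β : Type*} (M : Matroid β) (c : β → ℝ) (F : Finset β) :
    ∃ I ⊆ F, M.Indep I ∧ weightedRank M c F = ∑ e ∈ I, c e := by
  obtain ⟨I, hI, h⟩ := Finset.exists_mem_eq_sup' (indepSubsets_nonempty M F)
    (fun I => ∑ e ∈ I, c e)
  exact ⟨I, (mem_indepSubsets.1 hI).1, (mem_indepSubsets.1 hI).2, h⟩

/-- The M♮-exchange property of the weighted rank function. -/
theorem weightedRank_exchange {β : Type*} [DecidableEq β] (M : Matroid β) (c : β → ℝ)
    (X Y : Finset β) {x : β} (hx : x ∈ X \ Y) :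
    weightedRank M c X + weightedRank M c Y ≤
        weightedRank M c (X.erase x) + weightedRank M c (insert x Y) ∨
      ∃ y ∈ Y \ X, weightedRank M c X + weightedRank M c Y ≤
        weightedRank M c (insert y (X.erase x)) + weightedRank M c (insert x (Y.erase y)) := by
  obtain ⟨hxX, hxY⟩ := Finset.mem_sdiff.1 hx
  obtain ⟨I, hIX, hI, eI⟩ := exists_weightedRank_eq M c X
  obtain ⟨J, hJY, hJ, eJ⟩ := exists_weightedRank_eq M c Y
  rw [eI, eJ]
  have hxJ : x ∉ J := fun h => hxY (hJY h)
  by_cases hxI : x ∈ I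
  swap
  · left
    exact add_le_add (sum_le_weightedRank c (by grind) hI) (sum_le_weightedRank c (by grind) hJ)
  have sI : ∑ e ∈ I, c e = c x + ∑ e ∈ I.erase x, c e := (Finset.add_sum_erase I c hxI).symm
  by_cases hJx : M.Indep (insert x J : Finset β)
  · left
    have h1 := sum_le_weightedRank (F := X.erase x) (I := I.erase x) (M := M) c (by grind)
      (hI.subset (by simp))
    have h2 := sum_le_weightedRank (F := insert x Y) (I := insert x J) c (by grind) hJx
    rw [Finset.sum_insert hxJ] at h2
    linarith
  rw [Finset.coe_insert] at hJx
  obtain ⟨y, hy, hIy, hJy⟩ := hI.exists_symm_exchange hJ hxI hxJ hJx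
  obtain ⟨hyJ, hyI⟩ := hy
  rw [Finset.mem_coe] at hyJ hyI
  have hyx : y ≠ x := fun h => hyI (h ▸ hxI)
  have sJ : ∑ e ∈ J, c e = c y + ∑ e ∈ J.erase y, c e := (Finset.add_sum_erase J c hyJ).symm
  have hIy' : M.Indep (insert y (I.erase x) : Finset β) := by simpa using hIy
  have hJy' : M.Indep (insert x (J.erase y) : Finset β) := by simpa using hJy
  have s1 : ∑ e ∈ insert y (I.erase x), c e = c y + ∑ e ∈ I.erase x, c e :=
    Finset.sum_insert (by grind)
  have s2 : ∑ e ∈ insert x (J.erase y), c e = c x + ∑ e ∈ J.erase y, c e :=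
    Finset.sum_insert (by grind)
  -- If `y` is already in `X`, both exchanged independent sets fit without moving `y` between `X`
  -- and `Y`.
  by_cases hyX : y ∈ X
  · left
    have h1 := sum_le_weightedRank (F := X.erase x) c (by grind) hIy'
    have h2 := sum_le_weightedRank (F := insert x Y) c (by grind) hJy'
    linarith
  · right
    refine ⟨y, Finset.mem_sdiff.2 ⟨hJY hyJ, hyX⟩, ?_⟩
    have h1 := sum_le_weightedRank (F := insert y (X.erase x)) c (by grind) hIy'
    have h2 := sum_le_weightedRank (F := insert x (Y.erase y)) c (by grind) hJy'
    linarith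

/-- Points of `δ` are inert, so the cases depend on which of the four points lie in `β`. Two or
three such points give submodularity, a trivial bound or a mixed-size relation. With four, a failure
would force the exchange to return no element for both `i` and `j`; adding these bounds contradicts
submodularity over `S + i` and `S + j`. -/
theorem SatisfiesPlucker.of_exchange {β δ : Type*} [DecidableEq β] [DecidableEq δ]
    {f : Finset β → ℝ}
    (hf : ∀ X Y : Finset β, ∀ x ∈ X \ Y, f X + f Y ≤ f (X.erase x) + f (insert x Y) ∨
      ∃ y ∈ Y \ X, f X + f Y ≤ f (insert y (X.erase x)) + f (insert x (Y.erase y)))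
    (W : Finset (β ⊕ δ)) : SatisfiesPlucker W (fun B => f B.toLeft) := by
  have sub : ∀ (S : Finset β) (i j : β), i ∉ S → j ∉ S → i ≠ j →
      f (insert i (insert j S)) + f S ≤ f (insert i S) + f (insert j S) := by
    intro S i j hi hj hij
    have hx : i ∈ insert i (insert j S) \ S := by grind
    rcases hf _ _ i hx with h | ⟨y, hy, -⟩
    · rw [Finset.erase_insert (by grind)] at h
      linarith
    · grind
  have three : ∀ (S : Finset β) (i j k : β), i ∉ S → j ∉ S → k ∉ S → i ≠ j → i ≠ k → j ≠ k →
      f (insert i (insert j S)) + f (insert k S) ≤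
        max (f (insert i (insert k S)) + f (insert j S))
          (f (insert i S) + f (insert j (insert k S))) := by
    intro S i j k hi hj hk hij hik hjk
    have hx : i ∈ insert i (insert j S) \ insert k S := by grind
    rw [le_max_iff]
    rcases hf _ _ i hx with h | ⟨y, hy, h⟩
    · rw [Finset.erase_insert (by grind)] at h
      exact Or.inl (by linarith)
    · obtain rfl : y = k := by grind
      rw [Finset.erase_insert (by grind), Finset.erase_insert hk, Finset.insert_comm y j] at h
      exact Or.inr (by linarith)
  have four : ∀ (S : Finset β) (i j k l : β), i ∉ S → j ∉ S → k ∉ S → l ∉ S →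
      i ≠ j → i ≠ k → i ≠ l → j ≠ k → j ≠ l → k ≠ l →
      f (insert i (insert j S)) + f (insert k (insert l S)) ≤
        max (f (insert i (insert k S)) + f (insert j (insert l S)))
          (f (insert i (insert l S)) + f (insert j (insert k S))) := by
    intro S i j k l hi hj hk hl hij hik hil hjk hjl hkl
    by_contra! hlt
    rw [max_lt_iff] at hlt
    obtain ⟨l1, l2⟩ := hlt
    have step : ∀ i j, i ∉ S → j ∉ S → i ≠ j → i ≠ k → i ≠ l → j ≠ k → j ≠ l →
        f (insert i (insert k S)) + f (insert j (insert l S)) <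
          f (insert i (insert j S)) + f (insert k (insert l S)) →
        f (insert i (insert l S)) + f (insert j (insert k S)) <
          f (insert i (insert j S)) + f (insert k (insert l S)) →
        f (insert i (insert j S)) + f (insert k (insert l S)) ≤
          f (insert j S) + f (insert i (insert k (insert l S))) := by
      intro i j hi hj hij hik hil hjk hjl l1 l2
      have hx : i ∈ insert i (insert j S) \ insert k (insert l S) := by grind
      rcases hf _ _ i hx with h | ⟨y, hy, h⟩
      · rwa [Finset.erase_insert (by grind)] at h
      · rw [Finset.erase_insert (by grind)] at h
        have hy' : y = k ∨ y = l := by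
          simp only [Finset.mem_sdiff, Finset.mem_insert] at hy
          tauto
        rcases hy' with rfl | rfl
        · rw [Finset.erase_insert (by grind), Finset.insert_comm y j] at h
          linarith
        · have e : (insert k (insert y S)).erase y = insert k S := by
            rw [Finset.insert_comm, Finset.erase_insert (by grind)]
          rw [e, Finset.insert_comm y j] at h
          linarith
    have s1 := step i j hi hj hij hik hil hjk hjl l1 l2
    have s2 := step j i hj hi hij.symm hjk hjl hik hil (by rw [Finset.insert_comm j i]; linarith)
      (by rw [Finset.insert_comm j i]; linarith)
    rw [Finset.insert_comm j i] at s2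
    have t1 := sub (insert i S) k l (by grind) (by grind) hkl
    have t2 := sub (insert j S) k l (by grind) (by grind) hkl
    rw [Finset.insert_comm l i S, Finset.insert_comm k i, Finset.insert_comm k i] at t1
    rw [Finset.insert_comm l j S, Finset.insert_comm k j, Finset.insert_comm k j] at t2
    linarith
  intro S _ i _ j _ k _ l _ hi hj hk hl hij hik hil hjk hjl hkl
  clear hf
  rcases i with i | i <;> rcases j with j | j <;> rcases k with k | k <;> rcases l with l | l <;>
    simp only [Finset.toLeft_insert_inl, Finset.toLeft_insert_inr, ne_eq, Sum.inl.injEq,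
      ← Finset.mem_toLeft] at *
  · exact four _ i j k l hi hj hk hl hij hik hil hjk hjl hkl
  · exact three _ i j k hi hj hk hij hik hjk
  · have := three _ i j l hi hj hl hij hil hjl
    rwa [max_comm] at this
  · have := sub _ i j hi hj hij
    exact le_max_of_le_left this
  · have := three _ k l i hk hl hi hkl (Ne.symm hik) (Ne.symm hil)
    rw [Finset.insert_comm k i, Finset.insert_comm l i] at this
    rw [le_max_iff] at this ⊢
    exact this.imp (fun r => by linarith) (fun r => by linarith)
  · exact le_max_of_le_right le_rfl
  · exact le_max_of_le_left (by linarith)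
  · exact le_max_of_le_right le_rfl
  · have := three _ k l j hk hl hj hkl (Ne.symm hjk) (Ne.symm hjl)
    rw [Finset.insert_comm k j, Finset.insert_comm l j] at this
    rw [le_max_iff] at this ⊢
    exact this.symm.imp (fun r => by linarith) (fun r => by linarith)
  · exact le_max_of_le_left (by linarith)
  · exact le_max_of_le_right (by linarith)
  · exact le_max_of_le_left (by linarith)
  · have := sub _ k l hk hl hkl
    exact le_max_of_le_left (by linarith)
  · exact le_max_of_le_left (by linarith)
  · exact le_max_of_le_left (by linarith)
  · exact le_max_of_le_left le_rfl

/-! ### Aggregation along a map. -/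

/-- `M` selects at most one element over each member of `δ`, and only over members of `S`. -/
def IsSelection {β δ : Type*} (π : β → δ) (S : Finset (β ⊕ δ)) (M : Finset β) : Prop :=
  Set.InjOn π M ∧ ∀ e ∈ M, Sum.inr (π e) ∈ S

/-- Aggregating a valuation along a map `π`, one element at a time, preserves the three-term
relations. -/
theorem exists_aggregation {β δ : Type*} [Fintype β] [Fintype δ] [DecidableEq β] [DecidableEq δ]
    {f : Finset β → ℝ} (π : β → δ)
    (hf : SatisfiesPlucker Finset.univ (fun B : Finset (β ⊕ δ) => f B.toLeft)) (U : Finset β) :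
    ∃ ω : Finset (β ⊕ δ) → ℝ, SatisfiesPlucker (Finset.univ \ U.map .inl) ω ∧
      ∀ S, (∀ M ⊆ U, IsSelection π S M → f (S.toLeft ∪ M) ≤ ω S) ∧
        ∃ M ⊆ U, IsSelection π S M ∧ ω S = f (S.toLeft ∪ M) := by
  induction U using Finset.induction_on with
  | empty =>
    refine ⟨_, by simpa using hf, fun S => ⟨fun M hM _ => ?_, ∅, le_rfl, ?_, ?_⟩⟩
    · rw [Finset.subset_empty.1 hM, Finset.union_empty]
    · simp [IsSelection]
    · rw [Finset.union_empty]
  | insert b U hb ih =>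
    obtain ⟨ω, hω, hspec⟩ := ih
    refine ⟨mergeElements (.inr (π b)) (.inl b) ω, ?_, fun S => ⟨fun M hM hsel => ?_, ?_⟩⟩
    · have := hω.merge (a := .inr (π b)) (b := .inl b) (by simp) (by simpa using hb) (by simp)
      have e : (Finset.univ \ U.map .inl : Finset (β ⊕ δ)).erase (.inl b) =
          Finset.univ \ (insert b U).map .inl := by
        ext z
        simp only [Finset.mem_erase, Finset.mem_sdiff, Finset.mem_univ, true_and,
          Finset.map_insert, Finset.mem_insert, Function.Embedding.inl_apply, not_or]
      rwa [e] at this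
    -- If `b` is selected, no other selected element lies over `π b`, so that label can be replaced
    -- by `b` itself.
    · by_cases hbM : b ∈ M
      · have haS := hsel.2 b hbM
        have h := (hspec (insert (.inl b) (S.erase (.inr (π b))))).1 (M.erase b) (by grind)
          ⟨hsel.1.mono (by simp), fun e he => by
            have heM := Finset.mem_of_mem_erase he
            refine Finset.mem_insert_of_mem (Finset.mem_erase.2 ⟨fun h => ?_, hsel.2 e heM⟩)
            exact Finset.ne_of_mem_erase he (hsel.1 heM hbM (Sum.inr_injective h))⟩
        have e : (insert (Sum.inl b) (S.erase (.inr (π b)))).toLeft ∪ M.erase b =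
            S.toLeft ∪ M := by
          ext z
          simp only [Finset.mem_union, Finset.mem_toLeft, Finset.mem_insert, Finset.mem_erase,
            Sum.inl.injEq, ne_eq, reduceCtorEq, not_false_eq_true, true_and]
          by_cases hz : z = b <;> simp [hz, hbM]
        rw [e] at h
        rw [mergeElements, if_pos haS]
        exact le_max_of_le_right h
      · have h := (hspec S).1 M (by grind) hsel
        rw [mergeElements]
        split_ifs
        exacts [le_max_of_le_left h, h]
    · have old : ∃ M ⊆ insert b U, IsSelection π S M ∧ ω S = f (S.toLeft ∪ M) := by
        obtain ⟨M, hM, hsel, h⟩ := (hspec S).2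
        exact ⟨M, hM.trans (Finset.subset_insert _ _), hsel, h⟩
      by_cases haS : Sum.inr (π b) ∈ S
      swap
      · rwa [mergeElements, if_neg haS]
      rw [mergeElements, if_pos haS]
      rcases max_choice (ω S) (ω (insert (.inl b) (S.erase (.inr (π b))))) with h | h
      · rwa [h]
      · rw [h]
        obtain ⟨M, hM, hsel, h⟩ := (hspec (insert (.inl b) (S.erase (.inr (π b))))).2
        -- The label `π b` was erased, so adding `b` keeps `π` injective on the selection.
        have hmem : ∀ e ∈ M, π e ≠ π b ∧ Sum.inr (π e) ∈ S := by
          intro e he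
          simpa using hsel.2 e he
        refine ⟨insert b M, Finset.insert_subset_insert b hM, ⟨?_, ?_⟩, ?_⟩
        · rw [Finset.coe_insert, Set.injOn_insert (fun h => hb (hM h))]
          refine ⟨hsel.1, ?_⟩
          rintro ⟨e, he, hπ⟩
          exact (hmem e he).1 hπ
        · intro e he
          rcases Finset.mem_insert.1 he with rfl | he
          exacts [haS, (hmem e he).2]
        · rw [h]
          congr 1
          ext z
          simp only [Finset.mem_union, Finset.mem_toLeft, Finset.mem_insert, Finset.mem_erase,
            Sum.inl.injEq, ne_eq, reduceCtorEq, not_false_eq_true, true_and]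
          tauto

/-! ### Rado valuations as aggregated weighted ranks. -/

theorem radoValuation_nonneg {G T : Type*} [DecidableEq G] [DecidableEq T]
    (E : Finset (G × T)) (c : G × T → ℝ) (M : Matroid T) (S : Finset G) :
    0 ≤ radoValuation E c M S :=
  (radoValuation_isGreatest E c M S).2 ⟨∅, by simp [IsRadoFeasible, IsBipMatching], by simp⟩

theorem radoValuation_empty {G T : Type*} [DecidableEq G] [DecidableEq T]
    (E : Finset (G × T)) (c : G × T → ℝ) (M : Matroid T) : radoValuation E c M ∅ = 0 := by
  obtain ⟨N, ⟨-, hN, -⟩, h⟩ := (radoValuation_isGreatest E c M ∅).1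
  rw [h, Finset.image_eq_empty.1 (Finset.subset_empty.1 hN), Finset.sum_empty]

/-- Independence in a comap already includes injectivity of `Prod.snd`, so one matroid on edges
absorbs all conditions on the `T` side. -/
theorem isRadoFeasible_iff {G T : Type*} [DecidableEq G] [DecidableEq T]
    {E : Finset (G × T)} {M : Matroid T} {S : Finset G} {N : Finset (G × T)} :
    IsRadoFeasible E M S N ↔
      ((M.comap (Prod.snd : G × T → T)).restrict (E : Set (G × T))).Indep (N : Set (G × T)) ∧
        Set.InjOn Prod.fst (N : Set (G × T)) ∧
        ∀ e ∈ N, e.1 ∈ S := by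
  rw [Matroid.restrict_indep_iff, Matroid.comap_indep_iff, Finset.coe_subset, IsRadoFeasible,
    IsBipMatching, Finset.image_subset_iff, Finset.coe_image]
  constructor
  · rintro ⟨⟨h1, h2⟩, h3, h4⟩
    refine ⟨⟨⟨h4, fun e he f hf hef => ?_⟩, h1⟩, fun e he f hf hef => ?_, h3⟩
    · by_contra hne
      exact (h2 e he f hf hne).2 hef
    · by_contra hne
      exact (h2 e he f hf hne).1 hef
  · rintro ⟨⟨⟨h4, h5⟩, h1⟩, h6, h3⟩
    exact ⟨⟨h1, fun e he f hf hne => ⟨fun h => hne (h6 he hf h), fun h => hne (h5 he hf h)⟩⟩,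
      h3, h4⟩

/-- A Rado valuation is the trace of a set function satisfying the three-term relations; `S`
represents the set of all `g` with `(g, true) ∈ S`, and the elements `(g, false)` are dummies. -/
theorem exists_plucker_radoValuation {G T : Type*} [Fintype G] [DecidableEq G] [Fintype T]
    [DecidableEq T] (E : Finset (G × T)) (c : G × T → ℝ) (M : Matroid T) :
    ∃ (W : Finset (G × T ⊕ G × Bool)) (ω : Finset (G × T ⊕ G × Bool) → ℝ),
      SatisfiesPlucker W ω ∧ (∀ z, Sum.inr z ∈ W) ∧
      ∀ (S : Finset (G × T ⊕ G × Bool)) (X : Finset G), S.toLeft = ∅ →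
        (∀ g, Sum.inr (g, true) ∈ S ↔ g ∈ X) → ω S = radoValuation E c M X := by
  -- Aggregation may run over all pairs: no set containing a pair outside `E` is independent in
  -- `M'`.
  set M' := (M.comap (Prod.snd : G × T → T)).restrict E with hM'
  obtain ⟨ω, hω, hspec⟩ := exists_aggregation (fun e : G × T => (e.1, true))
    (SatisfiesPlucker.of_exchange (fun X Y x hx => weightedRank_exchange M' c X Y hx)
      Finset.univ) Finset.univ
  refine ⟨_, ω, hω, fun z => by simp, fun S X hS hX => le_antisymm ?_ ?_⟩
  · obtain ⟨N, -, hsel, h⟩ := (hspec S).2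
    rw [h, hS, Finset.empty_union]
    obtain ⟨I, hIN, hI, hc⟩ := exists_weightedRank_eq M' c N
    refine (radoValuation_isGreatest E c M X).2 ⟨I, isRadoFeasible_iff.2 ⟨hI, ?_, ?_⟩, hc⟩
    · exact fun e he f hf hef => hsel.1 (hIN he) (hIN hf) (Prod.ext hef rfl)
    · exact fun e he => (hX e.1).1 (hsel.2 e (hIN he))
  · obtain ⟨N, hN, h⟩ := (radoValuation_isGreatest E c M X).1
    rw [h]
    obtain ⟨hI, hinj, hNX⟩ := isRadoFeasible_iff.1 hN
    refine (sum_le_weightedRank (M := M') c le_rfl hI).trans ?_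
    have := (hspec S).1 N (Finset.subset_univ N)
      ⟨fun e he f hf hef => hinj he hf (Prod.mk.inj hef).1, fun e he => (hX _).2 (hNX e he)⟩
    rwa [hS, Finset.empty_union] at this

theorem radoValuation_exchange {G T : Type*} [Fintype G] [DecidableEq G] [Fintype T]
    [DecidableEq T] (E : Finset (G × T)) (c : G × T → ℝ) (M : Matroid T) (X Y : Finset G) (x : G)
    (hx : x ∈ X \ Y) : ∃ Z : Finset G, Z ⊆ Y \ X ∧ Z.card ≤ 1 ∧
      radoValuation E c M X + radoValuation E c M Y ≤
        radoValuation E c M ((X \ {x}) ∪ Z) + radoValuation E c M ((Y \ Z) ∪ {x}) := by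
  obtain ⟨W, ω, hω, hW, hval⟩ := exists_plucker_radoValuation E c M
  -- Each item contributes exactly one of its two points, so all encoded sets have size `|G|`.
  set φ : Finset G → Finset (G × T ⊕ G × Bool) :=
    fun X => Finset.univ.image (fun g => Sum.inr (g, decide (g ∈ X))) with hφ
  have mem_inl : ∀ X e, Sum.inl e ∉ φ X := by simp [hφ]
  have mem_inr : ∀ X g b, Sum.inr (g, b) ∈ φ X ↔ decide (g ∈ X) = b := by simp [hφ]
  have card_φ : ∀ X, (φ X).card = Fintype.card G := fun X =>
    Finset.card_image_of_injective _ fun g g' h => congrArg Prod.fst (Sum.inr_injective h)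
  have sub_W : ∀ X, φ X ⊆ W := by
    intro X z hz
    rcases z with e | z
    exacts [absurd hz (mem_inl X e), hW z]
  have val : ∀ X, ω (φ X) = radoValuation E c M X := fun X =>
    hval _ _ (by ext e; simp [mem_inl]) (by simp [mem_inr])
  obtain ⟨hxX, hxY⟩ := Finset.mem_sdiff.1 hx
  obtain ⟨y, hy, hle⟩ := hω.exchange (sub_W X) (sub_W Y) ((card_φ X).trans (card_φ Y).symm)
    (x := Sum.inr (x, true)) (by simp [mem_inr, hxX, hxY])
  obtain ⟨hyY, hyX⟩ := Finset.mem_sdiff.1 hy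
  rw [val, val] at hle
  rcases y with e | ⟨g, b⟩
  · exact absurd hyY (mem_inl Y e)
  rw [mem_inr] at hyY hyX
  -- After the swap some item may have both of its points or neither, but `hval` reads only the
  -- points marked `true`. Receiving a dummy means `Z = ∅`; receiving `(g, true)` means `Z = {g}`.
  cases b
  · refine ⟨∅, by simp, by simp, ?_⟩
    rw [hval _ (X \ {x} ∪ ∅), hval _ (Y \ ∅ ∪ {x})] at hle
    · exact hle
    · ext e; simp [mem_inl]
    · intro g'
      simp [mem_inr]
    · ext e; simp [mem_inl]
    · intro g'
      simp [mem_inr, and_comm]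
  · rw [decide_eq_true_eq] at hyY hyX
    refine ⟨{g}, by simp [hyY, hyX], by simp, ?_⟩
    rw [hval _ (X \ {x} ∪ {g}), hval _ (Y \ {g} ∪ {x})] at hle
    · exact hle
    · ext e; simp [mem_inl]
    · intro g'
      simp [mem_inr]
      tauto
    · ext e; simp [mem_inl]
    · intro g'
      simp [mem_inr]
      tauto

/-! ### Gross substitutes from M♮-concavity. -/

/-- An M♮-concave function with `v ∅ = 0` is a gross substitutes valuation. -/
theorem IsMNaturalConcave.isGrossSubstitutes {G : Type*} [Fintype G] [DecidableEq G]
    {v : Finset G → ℝ} (hv : IsMNaturalConcave v) (h0 : v ∅ = 0) : IsGrossSubstitutes v := by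
  classical
  refine ⟨h0, hv.nonneg, fun p p' hp S hS => ?_⟩
  obtain ⟨S₀, -, hS₀⟩ := Finset.exists_max_image (Finset.univ : Finset (Finset G))
    (fun A => v A - ∑ j ∈ A, p' j) ⟨∅, Finset.mem_univ _⟩
  -- Among the sets demanded at `p'`, take one missing as few elements of `S` as possible.
  obtain ⟨S', hS', hmin⟩ := Finset.exists_min_image
    (Finset.univ.filter (fun A => A ∈ demand v p')) (fun A => (S \ A).card)
    ⟨S₀, by simpa [demand] using fun A => hS₀ A (Finset.mem_univ A)⟩
  have hS'd : S' ∈ demand v p' := (Finset.mem_filter.1 hS').2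
  refine ⟨S', hS'd, fun x hxS hpx => ?_⟩
  by_contra hxS'
  obtain ⟨Z, hZ, -, hle⟩ := hv.exchange S S' x (Finset.mem_sdiff.2 ⟨hxS, hxS'⟩)
  have hZS' : Z ⊆ S' := hZ.trans Finset.sdiff_subset
  have hZS : Disjoint S Z := Finset.disjoint_of_subset_right hZ Finset.disjoint_sdiff
  have sum1 : ∑ j ∈ (S \ {x}) ∪ Z, p j = ∑ j ∈ S, p j - p x + ∑ j ∈ Z, p j := by
    rw [Finset.sum_union (Finset.disjoint_of_subset_left Finset.sdiff_subset hZS),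
      ← Finset.sum_sdiff (Finset.singleton_subset_iff.2 hxS), Finset.sum_singleton]
    ring
  have sum2 : ∑ j ∈ (S' \ Z) ∪ {x}, p' j = ∑ j ∈ S', p' j - ∑ j ∈ Z, p' j + p' x := by
    rw [Finset.sum_union (by simp [hxS']), ← Finset.sum_sdiff hZS', Finset.sum_singleton]
    ring
  have hpZ : ∑ j ∈ Z, p j ≤ ∑ j ∈ Z, p' j := Finset.sum_le_sum fun j _ => hp j
  have h1 := hS ((S \ {x}) ∪ Z)
  -- Optimality of `S` at `p` bounds the exchange. Passing to `p'` loses nothing, as the price of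
  -- `x` is unchanged and the elements of `Z` being dropped only became dearer.
  have hd : (S' \ Z) ∪ {x} ∈ demand v p' := by
    intro A
    have h2 := hS'd A
    linarith
  have hcard := hmin _ (Finset.mem_filter.2 ⟨Finset.mem_univ _, hd⟩)
  refine absurd hcard (not_le.2 (Finset.card_lt_card (Finset.ssubset_iff_of_subset ?_ |>.2 ?_)))
  · intro z hz
    rw [Finset.mem_sdiff, Finset.mem_union, Finset.mem_sdiff, not_or] at hz
    rw [Finset.mem_sdiff]
    refine ⟨hz.1, fun hzS' => hz.2.1 ⟨hzS', fun hzZ => ?_⟩⟩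
    exact Finset.disjoint_left.1 hZS hz.1 hzZ
  · exact ⟨x, Finset.mem_sdiff.2 ⟨hxS, hxS'⟩, by simp⟩

theorem mainTheorem4 {G T : Type*} [Fintype G] [DecidableEq G] [Fintype T] [DecidableEq T]
    (E : Finset (G × T)) (c : G × T → ℝ) (M : Matroid T) (hM : M.E = Set.univ) :
    IsMNaturalConcave (radoValuation E c M) ∧ IsGrossSubstitutes (radoValuation E c M) := by
  have h : IsMNaturalConcave (radoValuation E c M) :=
    ⟨radoValuation_nonneg E c M, radoValuation_exchange E c M⟩
  exact ⟨h, h.isGrossSubstitutes (radoValuation_empty E c M)⟩
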